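/- Let $\mathfrak a$ be a finite set, let $\tau:\mathfrak a^{\mathbb Z}\to\mathfrak a^{\mathbb Z}$ be the shift, $(\tau z)_m=z_{m+1}$, and let $\mathsf X\subseteq\mathfrak a^{\mathbb Z}$ be a two-sided shift space, i.e. $\mathsf X$ is closed in the product topology (with $\mathfrak a$ discrete) and $\tau(\mathsf X)=\mathsf X$. Let $\mathbb F_{\mathfrak a}$ be the free group on $\mathfrak a$ and let $\theta_{\mathsf X}=\bigl((D_g),(\theta_g)\bigr)_{g\in\mathbb F_{\mathfrak a}}$ be the partial action of $\mathbb F_{\mathfrak a}$ on $\mathsf X$ given as follows. For $a\in\mathfrak a$ put $D_a=\{z\in\mathsf X: z_0=a\}$, $D_{a^{-1}}=\{z\in\mathsf X: z_{-1}=a\}$, let $\theta_a:D_{a^{-1}}\to D_a$ be the restriction of $\tau^{-1}$ and $\theta_{a^{-1}}:D_a\to D_{a^{-1}}$ the restriction of $\tau$. For $g=b_1b_2\cdots b_k$ in reduced form ($b_j\in\mathfrak a\cup\mathfrak a^{-1}$) let $\theta_g=\theta_{b_1}\circ\cdots\circ\theta_{b_k}$ (composition of partial maps), and let $D_g$ be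 the range of $\theta_g$. For a partial action $\theta$ of a group $G$ on a set $X$ with domains $(D_g)_{g\in G}$, let $C^*(X,\theta,G)$ be the universal $C^*$-algebra generated by a family $(s_g)_{g\in G}$ such that: the $s_g$ are partial isometries with commuting range projections; $s_e=1$; $s_{g^{-1}}=s_g^*$; $s_hs_i=s_hs_h^*s_{hi}$ for all $h,i\in G$; and the map $D_g\mapsto s_gs_g^*$ extends to a Boolean homomorphism from the Boolean algebra of subsets of $X$ generated by $\{D_g: g\in G\}$ to the Boolean algebra of projections of the abelian $C^*$-algebra $C^*(\{s_gs_g^*: g\in G\})$. Let $\tau^\star$ be the automorphism $f\mapsto f\circ\tau$ of $C(\mathsf X)$ and let $C(\mathsf X)\rtimes_{\tau^\star}\mathbb Z$ be the full crossed product, i.e. the universal $C^*$-algebra generated by a copy of $C(\mathsf X)$ and a unitary $U$ such that $UfU^*=f\circ\tau$ for all $f\in C(\mathsf X)$. Then every indicator function $1_{D_g}$, $g\in\mathbb F_{\mathfrak a}$, is continuous on $\mathsf X$; the $C^*$-algebra $C(\mathsf X)$ is generated by these functions, $C(\mathsf X)=C^*(\{1_{D_g}: g\in\mathbb F_{\mathfrak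 a}\})$; and there is a $*$-isomorphism from $C(\mathsf X)\rtimes_{\tau^\star}\mathbb Z$ onto $C^*(\mathsf X,\theta_{\mathsf X},\mathbb F_{\mathfrak a})$ which maps $1_{D_g}$ to $s_gs_g^*$ for every $g\in\mathbb F_{\mathfrak a}$ and $U$ to $\sum_{a\in\mathfrak a}s_a$. -/

import Mathlib

open scoped ENNReal

universe u v w

noncomputable section

/-! ### Universal C⋆-algebras on generators and relations -/

/-- The `ℓ^∞`-product of a family of C⋆-algebras. -/
instance lp.instCStarAlgebraInfty {J : Type u} {A : J → Type v} [∀ j, Nontrivial (A j)]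
    [∀ j, CStarAlgebra (A j)] : CStarAlgebra (lp A ∞) where

/-- Generators and relations for a unital C⋆-algebra: a property of families `(f i)` of elements of
unital C⋆-algebras, which bounds the norm of each `f i` uniformly over all such families. -/
structure CStarPresentation (I : Type u) where
  Rel : ∀ (A : Type u) [CStarAlgebra A], (I → A) → Prop
  bounded : ∀ i, ∃ C : ℝ, ∀ (A : Type u) [CStarAlgebra A] (f : I → A), Rel A f → ‖f i‖ ≤ C

/-- Evaluation of noncommutative polynomials in the variables `x_i`, `x_i^*` at a family. -/
def polyEval {I : Type u} {A : Type v} [CStarAlgebra A] (f : I → A) :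
    FreeAlgebra ℂ (I ⊕ I) →ₐ[ℂ] A :=
  FreeAlgebra.lift ℂ (Sum.elim f fun i => star (f i))

lemma polyEval_mem {I : Type u} {A : Type v} [CStarAlgebra A] (f : I → A)
    (x : A) : x ∈ StarAlgebra.adjoin ℂ (Set.range f) ↔ ∃ p, polyEval f p = x := by
  have h : (StarAlgebra.adjoin ℂ (Set.range f)).toSubalgebra = (polyEval f).range := by
    rw [StarAlgebra.adjoin_toSubalgebra, polyEval, ← Algebra.adjoin_range_eq_range_freeAlgebra_lift,
      Set.Sum.elim_range]
    congr 2
    ext y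
    simp only [Set.mem_star, Set.mem_range]
    exact exists_congr fun i => by rw [eq_comm, star_eq_iff_star_eq, eq_comm]
  rw [← StarSubalgebra.mem_toSubalgebra, h]
  rfl

lemma map_polyEval {I : Type u} {A B : Type v} [CStarAlgebra A] [CStarAlgebra B] (f : I → A)
    (φ : A →⋆ₐ[ℂ] B) (p) : φ (polyEval f p) = polyEval (fun i => φ (f i)) p := by
  have : φ.toAlgHom.comp (polyEval f) = polyEval (fun i => φ (f i)) := by
    apply FreeAlgebra.hom_ext
    funext i
    rcases i with i | i <;> simp [polyEval, map_star]
  exact DFunLike.congr_fun this p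

namespace CStarPresentation

variable {I : Type u} (R : CStarPresentation I)

/-- The set of all functions `p ↦ ‖p(f)‖` on noncommutative polynomials that come from a family
`f` in a nonzero C⋆-algebra satisfying the relations. It indexes (up to isomorphism) the
C⋆-algebras generated by such families. -/
def Index : Type u :=
  {ν : FreeAlgebra ℂ (I ⊕ I) → ℝ // ∃ (A : Type u) (_ : CStarAlgebra A) (f : I → A),
    Nontrivial A ∧ R.Rel A f ∧ ∀ p, ν p = ‖polyEval f p‖}

/-- The C⋆-algebra in which a chosen family with index `j` lives. -/
def Alg (j : R.Index) : Type u := j.2.choose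

instance (j : R.Index) : CStarAlgebra (R.Alg j) := j.2.choose_spec.choose

/-- The chosen family with index `j`. -/
def fam (j : R.Index) : I → R.Alg j := j.2.choose_spec.choose_spec.choose

lemma fam_spec (j : R.Index) : Nontrivial (R.Alg j) ∧ R.Rel (R.Alg j) (R.fam j) ∧
    ∀ p, j.1 p = ‖polyEval (R.fam j) p‖ := j.2.choose_spec.choose_spec.choose_spec

instance (j : R.Index) : Nontrivial (R.Alg j) := (R.fam_spec j).1

/-- The family `(f_j i)_j` in the product of all these C⋆-algebras. -/
def prodGen (i : I) : lp R.Alg ∞ :=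
  ⟨fun j => R.fam j i, memℓp_infty <| by
    obtain ⟨C, hC⟩ := R.bounded i
    refine ⟨C, ?_⟩
    rintro _ ⟨j, rfl⟩
    exact hC _ _ (R.fam_spec j).2.1⟩

/-- The C⋆-subalgebra of the product generated by this family. -/
def univSub : StarSubalgebra ℂ (lp R.Alg ∞) :=
  (StarAlgebra.adjoin ℂ (Set.range R.prodGen)).topologicalClosure

/-- The universal unital C⋆-algebra on the given generators and relations. -/
def Univ : Type u := R.univSub

instance : IsClosed (R.univSub : Set (lp R.Alg ∞)) :=
  StarSubalgebra.isClosed_topologicalClosure _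

instance : CStarAlgebra R.Univ := inferInstanceAs (CStarAlgebra R.univSub)

/-- The generators. -/
def gen (i : I) : R.Univ :=
  ⟨R.prodGen i, StarSubalgebra.le_topologicalClosure _ (StarAlgebra.subset_adjoin ℂ _ ⟨i, rfl⟩)⟩

/-- The `j`-th coordinate. -/
def coord (j : R.Index) : R.Univ →⋆ₐ[ℂ] R.Alg j where
  toFun x := x.1 j
  map_one' := rfl
  map_mul' _ _ := rfl
  map_zero' := rfl
  map_add' _ _ := rfl
  commutes' _ := rfl
  map_star' _ := rfl

lemma coord_gen (j : R.Index) (i : I) : R.coord j (R.gen i) = R.fam j i := rfl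

lemma ext_coord {x y : R.Univ} (h : ∀ j, R.coord j x = R.coord j y) : x = y :=
  Subtype.ext (lp.ext (funext h))

lemma norm_coord_le (j : R.Index) (x : R.Univ) : ‖R.coord j x‖ ≤ ‖x‖ :=
  lp.norm_apply_le_norm ENNReal.top_ne_zero x.1 j

/-- The inclusion into the product. -/
def incl : R.Univ →⋆ₐ[ℂ] lp R.Alg ∞ := R.univSub.subtype

/-- The generators generate. -/
lemma adjoin_gen : (StarAlgebra.adjoin ℂ (Set.range R.gen)).topologicalClosure = ⊤ := by
  rw [eq_top_iff]
  rintro x -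
  have hx : x.1 ∈ closure ((StarAlgebra.adjoin ℂ (Set.range R.prodGen) :
    StarSubalgebra ℂ (lp R.Alg ∞)) : Set (lp R.Alg ∞)) := x.2
  change x ∈ closure _
  have hind : Topology.IsInducing (fun y : R.Univ => y.1) := Topology.IsInducing.subtypeVal
  rw [hind.closure_eq_preimage_closure_image]
  refine closure_mono ?_ hx
  have h := StarAlgHom.map_adjoin R.incl (Set.range R.gen)
  rw [← Set.range_comp] at h
  have h2 : (R.incl ∘ R.gen) = R.prodGen := rfl
  rw [h2] at h
  rw [← h]
  exact le_rfl


lemma norm_polyEval_le {A : Type u} [CStarAlgebra A] (f : I → A) (hf : R.Rel A f)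
    (p : FreeAlgebra ℂ (I ⊕ I)) : ‖polyEval f p‖ ≤ ‖polyEval R.gen p‖ := by
  rcases subsingleton_or_nontrivial A with h | h
  · rw [Subsingleton.elim (polyEval f p) 0, norm_zero]
    exact norm_nonneg _
  · let j : R.Index := ⟨fun p => ‖polyEval f p‖, A, inferInstance, f, h, hf, fun _ => rfl⟩
    have h1 : ‖polyEval f p‖ = ‖polyEval (R.fam j) p‖ := (R.fam_spec j).2.2 p
    rw [h1]
    have h2 := R.norm_coord_le j (polyEval R.gen p)
    rwa [map_polyEval] at h2

lemma hom_ext {A : Type u} [CStarAlgebra A] {φ ψ : R.Univ →⋆ₐ[ℂ] A}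
    (h : ∀ i, φ (R.gen i) = ψ (R.gen i)) : φ = ψ := by
  have h1 : (⊤ : StarSubalgebra ℂ R.Univ) ≤ StarAlgHom.equalizer φ ψ := by
    rw [← R.adjoin_gen]
    refine StarSubalgebra.topologicalClosure_minimal (StarAlgebra.adjoin_le ?_) ?_
    · rintro _ ⟨i, rfl⟩
      exact h i
    · exact isClosed_eq
        (AddMonoidHomClass.continuous_of_bound φ 1 fun x => by
          simpa using NonUnitalStarAlgHom.norm_apply_le φ x)
        (AddMonoidHomClass.continuous_of_bound ψ 1 fun x => by
          simpa using NonUnitalStarAlgHom.norm_apply_le ψ x)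
  ext x
  exact h1 (show x ∈ ⊤ from trivial)

/-- The universal property: `R.Univ` is generated by the family `R.gen`, and every family satisfying
the relations in a C⋆-algebra is the image of `R.gen` under a unique ⋆-homomorphism. -/
theorem existsUnique_lift {A : Type u} [CStarAlgebra A] (f : I → A) (hf : R.Rel A f) :
    ∃! φ : R.Univ →⋆ₐ[ℂ] A, ∀ i, φ (R.gen i) = f i := by
  refine existsUnique_of_exists_of_unique ?_ fun φ ψ hφ hψ => R.hom_ext fun i => by rw [hφ, hψ]
  let g : I → R.Univ × A := fun i => (R.gen i, f i)
  let T : StarSubalgebra ℂ (R.Univ × A) :=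
    (StarAlgebra.adjoin ℂ (Set.range g)).topologicalClosure
  have hTc : IsClosed (T : Set (R.Univ × A)) := StarSubalgebra.isClosed_topologicalClosure _
  have hfst : ∀ p, (polyEval g p).1 = polyEval R.gen p := fun p =>
    map_polyEval g (StarAlgHom.fst ℂ R.Univ A) p
  have hsnd : ∀ p, (polyEval g p).2 = polyEval f p := fun p =>
    map_polyEval g (StarAlgHom.snd ℂ R.Univ A) p
  have hnorm : ∀ x ∈ T, ‖x‖ = ‖x.1‖ := by
    intro x hx
    refine closure_minimal (t := {x : R.Univ × A | ‖x‖ = ‖x.1‖}) ?_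
      (isClosed_eq (by fun_prop) (by fun_prop)) hx
    intro y hy
    obtain ⟨p, rfl⟩ := (polyEval_mem g y).1 hy
    change max _ _ = _
    rw [hfst, hsnd]
    exact max_eq_left (R.norm_polyEval_le f hf p)
  let π : T →⋆ₐ[ℂ] R.Univ := (StarAlgHom.fst ℂ R.Univ A).comp T.subtype
  have hiso : Isometry π := AddMonoidHomClass.isometry_of_norm π fun x => (hnorm x.1 x.2).symm
  have hgT : ∀ i, g i ∈ T := fun i =>
    StarSubalgebra.le_topologicalClosure _ (StarAlgebra.subset_adjoin ℂ _ ⟨i, rfl⟩)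
  have hsurj : Function.Surjective π := by
    have hcl : IsClosed (Set.range π) := by
      have : CompleteSpace T := hTc.completeSpace_coe
      exact hiso.isClosedEmbedding.isClosed_range
    have htop : (⊤ : StarSubalgebra ℂ R.Univ) ≤ π.range := by
      rw [← R.adjoin_gen]
      refine StarSubalgebra.topologicalClosure_minimal (StarAlgebra.adjoin_le ?_) ?_
      · rintro _ ⟨i, rfl⟩
        exact ⟨⟨g i, hgT i⟩, rfl⟩
      · exact hcl
    intro x
    exact htop (show x ∈ ⊤ from trivial)
  let e : T ≃⋆ₐ[ℂ] R.Univ := StarAlgEquiv.ofBijective π ⟨hiso.injective, hsurj⟩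
  refine ⟨((StarAlgHom.snd ℂ R.Univ A).comp T.subtype).comp (e.symm : R.Univ →⋆ₐ[ℂ] T), ?_⟩
  intro i
  have hi : e.symm (R.gen i) = ⟨g i, hgT i⟩ := by
    rw [StarAlgEquiv.symm_apply_eq]
    rfl
  change (e.symm (R.gen i)).1.2 = f i
  rw [hi]

end CStarPresentation

/-! ### Crossed products by a single automorphism -/

section CrossedProduct

variable {B : Type u} [CStarAlgebra B] (α : B ≃⋆ₐ[ℂ] B)

/-- A copy of `B` together with a unitary `U` such that `U b U^* = α(b)`. -/
def crossedPresentation : CStarPresentation (B ⊕ Unit) where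
  Rel A _ f := ∃ π : B →⋆ₐ[ℂ] A, (∀ b, f (.inl b) = π b) ∧ f (.inr ()) ∈ unitary A ∧
    ∀ b, f (.inr ()) * π b * star (f (.inr ())) = π (α b)
  bounded := by
    rintro (b | _)
    · refine ⟨‖b‖, ?_⟩
      rintro A _ f ⟨π, h, -⟩
      rw [h]
      exact NonUnitalStarAlgHom.norm_apply_le π b
    · refine ⟨1, ?_⟩
      rintro A _ f ⟨π, -, h, -⟩
      rcases subsingleton_or_nontrivial A with hA | hA
      · rw [Subsingleton.elim (f _) 0, norm_zero]
        exact zero_le_one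
      · exact (CStarRing.norm_of_mem_unitary h).le

/-- The full crossed product `B ⋊_α ℤ`: the universal C⋆-algebra generated by a copy of `B` and a
unitary `U` such that `U b U^* = α(b)`. -/
abbrev CrossedProduct : Type u := (crossedPresentation α).Univ

namespace CrossedProduct

lemma rel_coord (j : (crossedPresentation α).Index) :
    ∃ π : B →⋆ₐ[ℂ] (crossedPresentation α).Alg j,
      (∀ b, (crossedPresentation α).fam j (.inl b) = π b) ∧
        (crossedPresentation α).fam j (.inr ()) ∈ unitary ((crossedPresentation α).Alg j) ∧
        ∀ b, (crossedPresentation α).fam j (.inr ()) * π b *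
          star ((crossedPresentation α).fam j (.inr ())) = π (α b) :=
  ((crossedPresentation α).fam_spec j).2.1

/-- The copy of `B` in `B ⋊_α ℤ`. -/
def ι : B →⋆ₐ[ℂ] CrossedProduct α where
  toFun b := (crossedPresentation α).gen (.inl b)
  map_one' := (crossedPresentation α).ext_coord fun j => by
    obtain ⟨π, h, -⟩ := rel_coord α j
    rw [CStarPresentation.coord_gen, h, map_one, map_one]
  map_mul' a b := (crossedPresentation α).ext_coord fun j => by
    obtain ⟨π, h, -⟩ := rel_coord α j
    rw [map_mul, CStarPresentation.coord_gen, CStarPresentation.coord_gen,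
      CStarPresentation.coord_gen, h, h, h, map_mul]
  map_zero' := (crossedPresentation α).ext_coord fun j => by
    obtain ⟨π, h, -⟩ := rel_coord α j
    rw [CStarPresentation.coord_gen, h, map_zero, map_zero]
  map_add' a b := (crossedPresentation α).ext_coord fun j => by
    obtain ⟨π, h, -⟩ := rel_coord α j
    rw [map_add, CStarPresentation.coord_gen, CStarPresentation.coord_gen,
      CStarPresentation.coord_gen, h, h, h, map_add]
  commutes' c := (crossedPresentation α).ext_coord fun j => by
    obtain ⟨π, h, -⟩ := rel_coord α j
    rw [AlgHomClass.commutes, CStarPresentation.coord_gen, h, AlgHomClass.commutes]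
  map_star' b := (crossedPresentation α).ext_coord fun j => by
    obtain ⟨π, h, -⟩ := rel_coord α j
    rw [map_star, CStarPresentation.coord_gen, CStarPresentation.coord_gen, h, h, map_star]

/-- The implementing unitary `U` of `B ⋊_α ℤ`. -/
def U : CrossedProduct α := (crossedPresentation α).gen (.inr ())

lemma U_mem : U α ∈ unitary (CrossedProduct α) := by
  rw [Unitary.mem_iff]
  constructor
  · refine (crossedPresentation α).ext_coord fun j => ?_
    obtain ⟨π, -, h, -⟩ := rel_coord α j
    rw [map_mul, map_star, map_one]
    exact Unitary.star_mul_self_of_mem h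
  · refine (crossedPresentation α).ext_coord fun j => ?_
    obtain ⟨π, -, h, -⟩ := rel_coord α j
    rw [map_mul, map_star, map_one]
    exact Unitary.mul_star_self_of_mem h

lemma covariance (b : B) : U α * ι α b * star (U α) = ι α (α b) := by
  refine (crossedPresentation α).ext_coord fun j => ?_
  obtain ⟨π, h1, -, h⟩ := rel_coord α j
  rw [map_mul, map_mul, map_star]
  have h2 : ∀ b, (crossedPresentation α).coord j (ι α b) = π b := h1
  rw [h2, h2]
  exact h b

/-- The universal property of `B ⋊_α ℤ`. -/
theorem existsUnique_lift {A : Type u} [CStarAlgebra A] (π : B →⋆ₐ[ℂ] A) (u : A)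
    (hu : u ∈ unitary A) (h : ∀ b, u * π b * star u = π (α b)) :
    ∃! φ : CrossedProduct α →⋆ₐ[ℂ] A, (∀ b, φ (ι α b) = π b) ∧ φ (U α) = u := by
  obtain ⟨φ, hφ, hφ'⟩ := (crossedPresentation α).existsUnique_lift (Sum.elim π fun _ => u)
    ⟨π, fun _ => rfl, hu, h⟩
  refine ⟨φ, ⟨fun b => hφ (.inl b), hφ (.inr ())⟩, ?_⟩
  rintro ψ ⟨h1, h2⟩
  refine hφ' ψ ?_
  rintro (b | _)
  · exact h1 b
  · exact h2

end CrossedProduct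

end CrossedProduct

/-! ### Partial actions -/

/-- A partial action of a group `G` on a set `X`. The partial one-to-one map `map g` is a bijection
from `dom g⁻¹` onto `dom g`; its values outside `dom g⁻¹` carry no information. -/
structure PartialAction (G : Type u) [Group G] (X : Type v) where
  /-- the domains `D_g` -/
  dom : G → Set X
  /-- the partial one-to-one maps `θ_g : D_{g⁻¹} → D_g` -/
  map : G → PartialEquiv X X
  source_map : ∀ g, (map g).source = dom g⁻¹
  target_map : ∀ g, (map g).target = dom g
  dom_one : dom 1 = Set.univ
  map_one_apply : ∀ x, map 1 x = x
  image_dom : ∀ h i, map h '' (dom i ∩ dom h⁻¹) = dom h ∩ dom (h * i)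
  map_mul_apply : ∀ h i x, x ∈ dom i⁻¹ ∩ dom (i⁻¹ * h⁻¹) → map h (map i x) = map (h * i) x

/-! ### Two-sided symbolic dynamical systems -/

/-- The shift map `τ` on `𝔞^ℤ`, `(τ z)_m = z_{m+1}`. -/
def shift (𝔞 : Type u) : (ℤ → 𝔞) ≃ (ℤ → 𝔞) where
  toFun z m := z (m + 1)
  invFun z m := z (m - 1)
  left_inv z := by funext m; simp
  right_inv z := by funext m; simp

/-- A two-sided symbolic dynamical system over the alphabet `𝔞`. -/
structure TwoSidedSystem (𝔞 : Type u) where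
  carrier : Set (ℤ → 𝔞)
  image_shift : shift 𝔞 '' carrier = carrier

/-- A two-sided shift space over `𝔞`: a closed subset of `𝔞^ℤ` with `τ(X) = X`. -/
structure ShiftSpace (𝔞 : Type u) [TopologicalSpace 𝔞] extends TwoSidedSystem 𝔞 where
  isClosed : IsClosed carrier

namespace TwoSidedSystem

variable {𝔞 : Type u} (X : TwoSidedSystem 𝔞)

/-- The underlying set of points, as a type. -/
abbrev Pt : Type u := X.carrier

lemma mem_iff (z : ℤ → 𝔞) : z ∈ X.carrier ↔ shift 𝔞 z ∈ X.carrier := by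
  constructor
  · intro h
    rw [← X.image_shift]
    exact ⟨z, h, rfl⟩
  · intro h
    rw [← X.image_shift] at h
    obtain ⟨y, hy, hyz⟩ := h
    rwa [← (shift 𝔞).injective hyz]

/-- The restriction of the shift to a bijection of `X`. -/
def tau : Equiv.Perm X.Pt := (shift 𝔞).subtypeEquiv X.mem_iff

lemma tau_apply (z : X.Pt) (m : ℤ) : (X.tau z).1 m = z.1 (m + 1) := rfl

lemma tau_symm_apply (z : X.Pt) (m : ℤ) : (X.tau.symm z).1 m = z.1 (m - 1) := rfl

/-- `θ_a`, the restriction of `τ⁻¹` to a bijection from `D_{a⁻¹} = {z | z_{-1} = a}` onto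
`D_a = {z | z_0 = a}`. -/
def letterMap (a : 𝔞) : PartialEquiv X.Pt X.Pt where
  toFun := X.tau.symm
  invFun := X.tau
  source := {z | z.1 (-1) = a}
  target := {z | z.1 0 = a}
  map_source' z hz := by simpa [tau_symm_apply] using hz
  map_target' z hz := by simpa [tau_apply] using hz
  left_inv' z _ := by simp
  right_inv' z _ := by simp

/-- `θ_b` for `b ∈ 𝔞 ∪ 𝔞⁻¹`; the pair `(a, true)` stands for `a` and `(a, false)` for `a⁻¹`. -/
def symbolMap (b : 𝔞 × Bool) : PartialEquiv X.Pt X.Pt :=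
  if b.2 then X.letterMap b.1 else (X.letterMap b.1).symm

/-- `θ_{b₁} ∘ θ_{b₂} ∘ ⋯ ∘ θ_{b_k}` (composition of partial maps) for a word `b₁ b₂ ⋯ b_k`. -/
def wordMap : List (𝔞 × Bool) → PartialEquiv X.Pt X.Pt
  | [] => PartialEquiv.refl X.Pt
  | b :: w => (wordMap w).trans (X.symbolMap b)

lemma symbolMap_not (a : 𝔞) (b : Bool) : X.symbolMap (a, !b) = (X.symbolMap (a, b)).symm := by
  cases b <;> simp [symbolMap]

lemma wordMap_append (w w' : List (𝔞 × Bool)) :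
    X.wordMap (w ++ w') = (X.wordMap w').trans (X.wordMap w) := by
  induction w with
  | nil => simp [wordMap]
  | cons b w ih => simp [wordMap, ih, PartialEquiv.trans_assoc]

lemma wordMap_invRev (w : List (𝔞 × Bool)) :
    X.wordMap (FreeGroup.invRev w) = (X.wordMap w).symm := by
  induction w with
  | nil => simp [wordMap]
  | cons b w ih =>
    have h : FreeGroup.invRev (b :: w) = FreeGroup.invRev w ++ [(b.1, !b.2)] := by
      simp [FreeGroup.invRev]
    rw [h, wordMap_append, ih]
    simp [wordMap, symbolMap_not, PartialEquiv.trans_symm_eq_symm_trans_symm]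

/-- All the maps `θ_g` are restrictions of powers of the shift. -/
def power : FreeGroup 𝔞 →* Equiv.Perm X.Pt := FreeGroup.lift fun _ => X.tau⁻¹

lemma symbolMap_apply (b : 𝔞 × Bool) (x : X.Pt) :
    X.symbolMap b x = X.power (FreeGroup.mk [b]) x := by
  obtain ⟨a, b⟩ := b
  cases b <;> simp [symbolMap, power, letterMap]

lemma symbolMap_symm_apply (b : 𝔞 × Bool) (x : X.Pt) :
    (X.symbolMap b).symm x = (X.power (FreeGroup.mk [b])).symm x := by
  obtain ⟨a, b⟩ := b
  cases b
  · simp [symbolMap, power, letterMap]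
  · simp [symbolMap, power, letterMap]
    rfl

lemma mk_cons (b : 𝔞 × Bool) (w : List (𝔞 × Bool)) :
    FreeGroup.mk (b :: w) = FreeGroup.mk [b] * FreeGroup.mk w := by
  simp [FreeGroup.mul_mk]

lemma wordMap_apply (w : List (𝔞 × Bool)) (x : X.Pt) :
    X.wordMap w x = X.power (FreeGroup.mk w) x := by
  induction w with
  | nil => simp [wordMap, ← FreeGroup.one_eq_mk]
  | cons b w ih =>
    rw [mk_cons, map_mul, Equiv.Perm.mul_apply, ← ih, ← symbolMap_apply]
    rfl

lemma mem_target_cons (b : 𝔞 × Bool) (w : List (𝔞 × Bool)) (x : X.Pt) :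
    x ∈ (X.wordMap (b :: w)).target ↔
      x ∈ (X.symbolMap b).target ∧
        (X.power (FreeGroup.mk [b])).symm x ∈ (X.wordMap w).target := by
  rw [← symbolMap_symm_apply]
  simp [wordMap, PartialEquiv.trans_target]

open Classical in
/-- `D_g`, the range of `θ_{b₁} ∘ ⋯ ∘ θ_{b_k}` where `b₁ ⋯ b_k` is the reduced form of `g`. -/
def dom (g : FreeGroup 𝔞) : Set X.Pt := (X.wordMap g.toWord).target

open Classical in
lemma mem_dom_symbol_mul (b : 𝔞 × Bool) (g : FreeGroup 𝔞) (x : X.Pt)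
    (hx : x ∈ (X.symbolMap b).target) :
    (X.power (FreeGroup.mk [b])).symm x ∈ X.dom g ↔ x ∈ X.dom (FreeGroup.mk [b] * g) := by
  have hw : (FreeGroup.mk [b] * g).toWord = FreeGroup.reduce (b :: g.toWord) := by
    conv_lhs => rw [← FreeGroup.mk_toWord (x := g)]
    rw [FreeGroup.mul_mk, FreeGroup.toWord_mk]
    rfl
  have hr := FreeGroup.reduce_toWord g
  unfold dom
  rw [hw, FreeGroup.reduce.cons, hr]
  rcases hg : g.toWord with _ | ⟨c, w⟩
  · simp [mem_target_cons, hx]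
  · by_cases hbc : b.1 = c.1 ∧ b.2 = !c.2
    · have hc : c = (b.1, !b.2) := by ext <;> simp [hbc]
      have hinv : FreeGroup.mk [c] = (FreeGroup.mk [b])⁻¹ := by simp [hc, FreeGroup.invRev]
      simp only [hbc, and_self, if_true]
      rw [mem_target_cons, hinv]
      have h1 : (X.power (FreeGroup.mk [b])).symm x ∈ (X.symbolMap c).target := by
        rw [hc, symbolMap_not, ← symbolMap_symm_apply]
        exact (X.symbolMap b).map_target hx
      rw [map_inv, ← Equiv.Perm.inv_def, ← Equiv.Perm.inv_def, inv_inv]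
      rw [Equiv.Perm.inv_def, Equiv.apply_symm_apply]
      exact and_iff_right h1
    · simp [hbc, mem_target_cons, hx]

open Classical in
lemma mem_dom_mul (w : List (𝔞 × Bool)) : FreeGroup.reduce w = w → ∀ (i : FreeGroup 𝔞) (x : X.Pt),
    x ∈ (X.wordMap w).target →
      ((X.power (FreeGroup.mk w)).symm x ∈ X.dom i ↔ x ∈ X.dom (FreeGroup.mk w * i)) := by
  induction w with
  | nil =>
    intro _ i x _
    simp [← FreeGroup.one_eq_mk]
    rfl
  | cons b w ih =>
    intro hred i x hx
    have hw : FreeGroup.reduce w = w := by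
      rw [← FreeGroup.isReduced_iff_reduce_eq] at hred ⊢
      exact hred.infix (List.suffix_cons b w).isInfix
    rw [mem_target_cons] at hx
    rw [mk_cons, mul_assoc, ← mem_dom_symbol_mul X b _ x hx.1, ← ih hw i _ hx.2, map_mul]
    rfl

open Classical in
/-- The partial action `θ_X` of the free group on a two-sided symbolic dynamical system. -/
def partialAction : PartialAction (FreeGroup 𝔞) X.Pt where
  dom := X.dom
  map g := X.wordMap g.toWord
  source_map g := by
    rw [dom, FreeGroup.toWord_inv, wordMap_invRev]
    rfl
  target_map g := rfl
  dom_one := by simp [dom, wordMap]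
  map_one_apply x := by simp [wordMap]
  image_dom h i := by
    have key : ∀ x ∈ X.dom h, ((X.power h).symm x ∈ X.dom i ↔ x ∈ X.dom (h * i)) := by
      intro x hx
      have := X.mem_dom_mul h.toWord (FreeGroup.reduce_toWord h) i x hx
      rwa [FreeGroup.mk_toWord] at this
    have hs : X.dom h⁻¹ = (X.wordMap h.toWord).source := by
      rw [dom, FreeGroup.toWord_inv, wordMap_invRev]
      rfl
    have ha : ∀ y, X.wordMap h.toWord y = X.power h y := fun y => by
      rw [wordMap_apply, FreeGroup.mk_toWord]
    ext x
    constructor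
    · rintro ⟨y, ⟨hyi, hyh⟩, rfl⟩
      rw [hs] at hyh
      have h1 : X.wordMap h.toWord y ∈ X.dom h := (X.wordMap h.toWord).map_source hyh
      refine ⟨h1, (key _ h1).1 ?_⟩
      rwa [ha, Equiv.symm_apply_apply]
    · rintro ⟨hx, hxi⟩
      refine ⟨(X.power h).symm x, ⟨(key x hx).2 hxi, ?_⟩, by rw [ha, Equiv.apply_symm_apply]⟩
      have h2 : (X.wordMap h.toWord).symm x = (X.power h).symm x := by
        rw [Equiv.eq_symm_apply, ← ha]
        exact (X.wordMap h.toWord).right_inv hx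
      rw [hs, ← h2]
      exact (X.wordMap h.toWord).map_target hx
  map_mul_apply h i x _ := by
    simp only [wordMap_apply, FreeGroup.mk_toWord, map_mul, Equiv.Perm.mul_apply]

end TwoSidedSystem

/-! ### The C⋆-algebra of a discrete partial dynamical system -/

namespace PartialAction

variable {G : Type u} [Group G] {X : Type v} (θ : PartialAction G X)

/-- The Boolean algebra of subsets of `X` generated by the domains. -/
def boolAlg : BooleanSubalgebra (Set X) := BooleanSubalgebra.closure (Set.range θ.dom)

lemma dom_mem (g : G) : θ.dom g ∈ θ.boolAlg := BooleanSubalgebra.subset_closure ⟨g, rfl⟩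

/-- The C⋆-algebra generated by the range projections `s g * (s g)^*`. -/
def rangeAlg {A : Type w} [CStarAlgebra A] (s : G → A) : StarSubalgebra ℂ A :=
  (StarAlgebra.adjoin ℂ (Set.range fun g => s g * star (s g))).topologicalClosure

/-- The defining relations of `C⋆(X, θ, G)`. The last one says that `D_g ↦ s_g s_g^*` extends to a
Boolean homomorphism `β` into the Boolean algebra of projections of the C⋆-algebra generated by the
(commuting) range projections, in which `p ⊓ q = p q`, `p ⊔ q = p + q - p q` and `pᶜ = 1 - p`. -/
structure IsRepresentation {A : Type w} [CStarAlgebra A] (s : G → A) : Prop where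
  partial_isometry : ∀ g, s g * star (s g) * s g = s g
  commute : ∀ g h, Commute (s g * star (s g)) (s h * star (s h))
  one : s 1 = 1
  inv : ∀ g, s g⁻¹ = star (s g)
  mul : ∀ h i, s h * s i = s h * star (s h) * s (h * i)
  boolean : ∃ β : θ.boolAlg → A,
    (∀ P, IsStarProjection (β P) ∧ β P ∈ rangeAlg s) ∧
    (∀ P Q, β (P ⊓ Q) = β P * β Q) ∧
    (∀ P Q, β (P ⊔ Q) = β P + β Q - β P * β Q) ∧
    (∀ P, β Pᶜ = 1 - β P) ∧
    ∀ g, β ⟨θ.dom g, θ.dom_mem g⟩ = s g * star (s g)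

/-- The generators and relations of `C⋆(X, θ, G)`. -/
def presentation : CStarPresentation G where
  Rel A _ s := θ.IsRepresentation s
  bounded g := by
    refine ⟨1, ?_⟩
    intro A _ s hs
    have hp : IsStarProjection (s g * star (s g)) :=
      ⟨by rw [IsIdempotentElem, ← mul_assoc, hs.partial_isometry], by simp [IsSelfAdjoint]⟩
    have h1 := IsStarProjection.norm_le _ hp
    rw [CStarRing.norm_self_mul_star] at h1
    nlinarith [norm_nonneg (s g)]

/-- `C⋆(X, θ, G)`: the universal C⋆-algebra generated by a family `(s_g)` satisfying the
relations above. -/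
abbrev CStar : Type u := θ.presentation.Univ

/-- The generators of `C⋆(X, θ, G)`. -/
def s (g : G) : θ.CStar := θ.presentation.gen g

lemma rep_coord (j : θ.presentation.Index) : θ.IsRepresentation (θ.presentation.fam j) :=
  (θ.presentation.fam_spec j).2.1

lemma coord_s (j : θ.presentation.Index) (g : G) :
    θ.presentation.coord j (θ.s g) = θ.presentation.fam j g := rfl

/-- The generators of `C⋆(X, θ, G)` satisfy the defining relations. -/
theorem isRepresentation_s : θ.IsRepresentation θ.s where
  partial_isometry g := θ.presentation.ext_coord fun j => by
    simpa only [map_mul, map_star, coord_s] using (θ.rep_coord j).partial_isometry g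
  commute g h := θ.presentation.ext_coord fun j => by
    simpa only [map_mul, map_star, coord_s] using ((θ.rep_coord j).commute g h).eq
  one := θ.presentation.ext_coord fun j => by
    rw [map_one, coord_s, (θ.rep_coord j).one]
  inv g := θ.presentation.ext_coord fun j => by
    simpa only [map_star, coord_s] using (θ.rep_coord j).inv g
  mul h i := θ.presentation.ext_coord fun j => by
    simpa only [map_mul, map_star, coord_s] using (θ.rep_coord j).mul h i
  boolean := by
    choose β hβ using fun j => (θ.rep_coord j).boolean
    have key : ∀ P : θ.boolAlg, ∃ x : θ.CStar,
        x ∈ rangeAlg θ.s ∧ ∀ j, θ.presentation.coord j x = β j P := by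
      rintro ⟨P, hP⟩
      refine BooleanSubalgebra.closure_bot_sup_induction (s := Set.range θ.dom)
        (p := fun P hP => ∃ x : θ.CStar, x ∈ rangeAlg θ.s ∧
          ∀ j, θ.presentation.coord j x = β j ⟨P, hP⟩) ?_ ?_ ?_ ?_ hP
      · rintro _ ⟨g, rfl⟩
        refine ⟨θ.s g * star (θ.s g), StarSubalgebra.le_topologicalClosure _
          (StarAlgebra.subset_adjoin ℂ _ ⟨g, rfl⟩), fun j => ?_⟩
        rw [(hβ j).2.2.2.2 g, map_mul, map_star, coord_s]
      · refine ⟨0, zero_mem _, fun j => ?_⟩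
        rw [map_zero]
        have h1 := (hβ j).2.1 ⊥ ⊥ᶜ
        rw [(hβ j).2.2.2.1 ⊥, mul_sub, mul_one, ((hβ j).1 ⊥).1.isIdempotentElem.eq, sub_self,
          inf_compl_eq_bot] at h1
        exact h1.symm
      · rintro P hP Q hQ ⟨x, hx, hx'⟩ ⟨y, hy, hy'⟩
        refine ⟨x + y - x * y, sub_mem (add_mem hx hy) (mul_mem hx hy), fun j => ?_⟩
        rw [map_sub, map_add, map_mul, hx', hy', ← (hβ j).2.2.1]
        rfl
      · rintro P hP ⟨x, hx, hx'⟩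
        refine ⟨1 - x, sub_mem (one_mem _) hx, fun j => ?_⟩
        rw [map_sub, map_one, hx', ← (hβ j).2.2.2.1]
        rfl
    choose b hb hb' using key
    refine ⟨b, fun P => ⟨⟨?_, ?_⟩, hb P⟩, fun P Q => ?_, fun P Q => ?_, fun P => ?_, fun g => ?_⟩
    · refine θ.presentation.ext_coord fun j => ?_
      rw [map_mul, hb']
      exact ((hβ j).1 P).1.isIdempotentElem
    · refine θ.presentation.ext_coord fun j => ?_
      rw [map_star, hb']
      exact ((hβ j).1 P).1.isSelfAdjoint
    · refine θ.presentation.ext_coord fun j => ?_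
      rw [map_mul, hb', hb', hb', (hβ j).2.1]
    · refine θ.presentation.ext_coord fun j => ?_
      rw [map_sub, map_add, map_mul, hb', hb', hb', (hβ j).2.2.1]
    · refine θ.presentation.ext_coord fun j => ?_
      rw [map_sub, map_one, hb', hb', (hβ j).2.2.2.1]
    · refine θ.presentation.ext_coord fun j => ?_
      rw [map_mul, map_star, hb', (hβ j).2.2.2.2, coord_s]

/-- The universal property of `C⋆(X, θ, G)`. -/
theorem existsUnique_lift {A : Type u} [CStarAlgebra A] (S : G → A) (hS : θ.IsRepresentation S) :
    ∃! φ : θ.CStar →⋆ₐ[ℂ] A, ∀ g, φ (θ.s g) = S g :=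
  θ.presentation.existsUnique_lift S hS

end PartialAction

/-! ### Shift spaces over a finite alphabet -/

namespace ShiftSpace

variable {𝔞 : Type u} [TopologicalSpace 𝔞] (X : ShiftSpace 𝔞)

instance [Finite 𝔞] : CompactSpace X.Pt := isCompact_iff_compactSpace.mp X.isClosed.isCompact

/-- The shift on `X` as a homeomorphism. -/
def tauHomeo : X.Pt ≃ₜ X.Pt where
  toEquiv := X.tau
  continuous_toFun := continuous_induced_rng.2 <|
    continuous_pi fun m => (continuous_apply (m + 1)).comp continuous_subtype_val
  continuous_invFun := continuous_induced_rng.2 <|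
    continuous_pi fun m => (continuous_apply (m - 1)).comp continuous_subtype_val

/-- The automorphism `τ^⋆ : f ↦ f ∘ τ` of `C(X)`. -/
def tauStar : C(X.Pt, ℂ) ≃⋆ₐ[ℂ] C(X.Pt, ℂ) := X.tauHomeo.compStarAlgEquiv' ℂ ℂ

lemma tauStar_apply (f : C(X.Pt, ℂ)) (x : X.Pt) : X.tauStar f x = f (X.tau x) := rfl

end ShiftSpace

end

/-!
The two universal properties give ⋆-homomorphisms in both directions, which are inverse to each
other on generators.

From `C⋆(X, θ_X, F)` to the crossed product: the elements `1_{D_g} U^{|g|}`, where `|g|` is the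
exponent sum of `g`, satisfy the defining relations (`ShiftSpace.isRepresentation_crossedRep`).
This holds because every `θ_g` is the restriction of the power `τ^{-|g|}` of the shift to `D_{g⁻¹}`;
the required Boolean homomorphism sends a set to its indicator function.

From the crossed product to `C⋆(X, θ_X, F)`: any representation `s` of `θ_X` induces a
representation `π` of `C(X)` with `π(1_{D_g}) = s_g s_g^*` (`ShiftSpace.exists_starAlgHom`). By
Gelfand duality it is enough to map the spectrum of the commutative C⋆-algebra of range projections
continuously to `X`. A character of this algebra composed with the Boolean homomorphism
`D_g ↦ s_g s_g^*` is a two-valued Boolean homomorphism on an algebra of clopen sets, which is the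
evaluation at a point by compactness of `X`. The sum `u = ∑ a, s_a` is unitary, since the domains
`D_a`, and likewise the domains `D_{a⁻¹}`, partition `X`; it implements the shift since
`τ⁻¹(D_g)` is the disjoint union of the sets `D_a ∩ D_{a g}` (`ShiftSpace.sum_covariant`).

The composites are identities since `s_g = s_g s_g^* u^{|g|}` (`ShiftSpace.range_mul_unitary`) and
since the functions `1_{D_g}` generate `C(X)` (`ShiftSpace.adjoin_domIndicator`). The latter is the
Stone–Weierstrass theorem: the sets `D_g` are clopen and separate points
(`TwoSidedSystem.eq_of_mem_dom_iff`).
-/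

noncomputable section

/-! ### The domains of the partial action -/

namespace TwoSidedSystem

variable {𝔞 : Type u} (X : TwoSidedSystem 𝔞)

lemma symbolMap_target (b : 𝔞 × Bool) :
    (X.symbolMap b).target = {z | z.1 (if b.2 then 0 else -1) = b.1} := by
  obtain ⟨a, b⟩ := b
  cases b <;> simp [symbolMap, letterMap]

lemma dom_eq_target (g : FreeGroup 𝔞) (w : List (𝔞 × Bool)) (hw : FreeGroup.IsReduced w)
    (hg : FreeGroup.mk w = g) : X.dom g = (X.wordMap w).target := by
  classical
  subst hg
  have h : (FreeGroup.mk w).toWord = w := by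
    rw [FreeGroup.toWord_mk]
    exact FreeGroup.isReduced_iff_reduce_eq.1 hw
  rw [dom]
  convert rfl
  exact h.symm

lemma dom_one : X.dom 1 = Set.univ := X.partialAction.dom_one

lemma dom_symbol (b : 𝔞 × Bool) : X.dom (FreeGroup.mk [b]) = (X.symbolMap b).target := by
  rw [X.dom_eq_target _ [b] (by simp) rfl]
  ext x
  simp [wordMap]

lemma mem_dom_symbol {b : 𝔞 × Bool} {x : X.Pt} :
    x ∈ X.dom (FreeGroup.mk [b]) ↔ x.1 (if b.2 then 0 else -1) = b.1 := by
  rw [dom_symbol, symbolMap_target]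
  rfl

lemma mem_dom_of {a : 𝔞} {x : X.Pt} : x ∈ X.dom (FreeGroup.of a) ↔ x.1 0 = a :=
  X.mem_dom_symbol (b := (a, true))

lemma mem_dom_of_inv {a : 𝔞} {x : X.Pt} : x ∈ X.dom (FreeGroup.of a)⁻¹ ↔ x.1 (-1) = a :=
  X.mem_dom_symbol (b := (a, false))

/-- There is no cancellation in a reduced product `b * w`, so `D_{b w} ⊆ D_b`. -/
lemma dom_cons_subset {b : 𝔞 × Bool} {w : List (𝔞 × Bool)} (h : FreeGroup.IsReduced (b :: w)) :
    X.dom (FreeGroup.mk (b :: w)) ⊆ X.dom (FreeGroup.mk [b]) := by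
  intro x hx
  rw [X.dom_eq_target _ _ h rfl, mem_target_cons] at hx
  rw [dom_symbol]
  exact hx.1

lemma power_of (a : 𝔞) : X.power (FreeGroup.of a) = X.tau⁻¹ := by simp [power]

lemma tau_mem_dom_iff {a : 𝔞} {x : X.Pt} (hx : x.1 0 = a) (g : FreeGroup 𝔞) :
    X.tau x ∈ X.dom g ↔ x ∈ X.dom (FreeGroup.of a * g) := by
  have h := X.mem_dom_symbol_mul (a, true) g x (by rw [symbolMap_target]; exact hx)
  change _ ↔ _ ∈ X.dom (FreeGroup.of a * g) at h
  rw [← h]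
  change _ ↔ (X.power (FreeGroup.of a)).symm x ∈ _
  rw [power_of]
  rfl

lemma tau_symm_mem_dom_iff {a : 𝔞} {x : X.Pt} (hx : x.1 (-1) = a) (g : FreeGroup 𝔞) :
    X.tau.symm x ∈ X.dom g ↔ x ∈ X.dom ((FreeGroup.of a)⁻¹ * g) := by
  have h := X.mem_dom_symbol_mul (a, false) g x (by rw [symbolMap_target]; exact hx)
  change _ ↔ _ ∈ X.dom ((FreeGroup.of a)⁻¹ * g) at h
  rw [← h]
  change _ ↔ (X.power (FreeGroup.of a)⁻¹).symm x ∈ _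
  rw [map_inv, power_of]
  rfl

lemma power_symm_mem_dom_iff {g : FreeGroup 𝔞} (i : FreeGroup 𝔞) {x : X.Pt} (hx : x ∈ X.dom g) :
    (X.power g).symm x ∈ X.dom i ↔ x ∈ X.dom (g * i) := by
  classical
  have h := X.mem_dom_mul g.toWord (FreeGroup.reduce_toWord g) i x
    (by rw [dom] at hx; convert hx)
  rwa [FreeGroup.mk_toWord] at h

lemma power_mem_dom_iff (g : FreeGroup 𝔞) (x : X.Pt) : X.power g x ∈ X.dom g ↔ x ∈ X.dom g⁻¹ := by
  have h (g : FreeGroup 𝔞) (x : X.Pt) (hx : x ∈ X.dom g⁻¹) : X.power g x ∈ X.dom g := by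
    have := (X.power_symm_mem_dom_iff (g := g⁻¹) g hx).2 (by rw [inv_mul_cancel, dom_one]; trivial)
    rwa [map_inv] at this
  refine ⟨fun hx => ?_, h g x⟩
  have := h g⁻¹ (X.power g x) (by rwa [inv_inv])
  rw [map_inv] at this
  simpa using this

/-- The domains `D_g` separate the points of `X`: two points in the same domains have the same
letter at `0`, and the relation is invariant under the shift and its inverse. -/
lemma eq_of_mem_dom_iff {x y : X.Pt} (h : ∀ g, x ∈ X.dom g ↔ y ∈ X.dom g) : x = y := by
  have h0 {x y : X.Pt} (h : ∀ g, x ∈ X.dom g ↔ y ∈ X.dom g) : x.1 0 = y.1 0 :=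
    (X.mem_dom_of.1 ((h (FreeGroup.of (x.1 0))).1 (X.mem_dom_of.2 rfl))).symm
  have h1 {x y : X.Pt} (h : ∀ g, x ∈ X.dom g ↔ y ∈ X.dom g) : x.1 (-1) = y.1 (-1) :=
    (X.mem_dom_of_inv.1 ((h (FreeGroup.of (x.1 (-1)))⁻¹).1 (X.mem_dom_of_inv.2 rfl))).symm
  have key (m : ℤ) : ∀ g, (X.tau ^ m) x ∈ X.dom g ↔ (X.tau ^ m) y ∈ X.dom g := by
    induction m with
    | zero => simpa using h
    | succ n ih =>
      intro g
      rw [add_comm, zpow_add, zpow_one, Equiv.Perm.mul_apply, Equiv.Perm.mul_apply,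
        X.tau_mem_dom_iff rfl, X.tau_mem_dom_iff (h0 ih).symm]
      exact ih _
    | pred n ih =>
      intro g
      rw [sub_eq_neg_add, zpow_add, zpow_neg_one, Equiv.Perm.mul_apply, Equiv.Perm.mul_apply]
      change X.tau.symm _ ∈ _ ↔ X.tau.symm _ ∈ _
      rw [X.tau_symm_mem_dom_iff rfl, X.tau_symm_mem_dom_iff (h1 ih).symm]
      exact ih _
  have coord (m : ℤ) : ∀ z : X.Pt, ((X.tau ^ m) z).1 0 = z.1 m := by
    induction m with
    | zero => simp
    | succ n ih =>
      intro z
      rw [zpow_add, zpow_one, Equiv.Perm.mul_apply, ih]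
      rfl
    | pred n ih =>
      intro z
      rw [zpow_sub, zpow_one, Equiv.Perm.mul_apply, ih]
      rfl
  refine Subtype.ext (funext fun m => ?_)
  rw [← coord m x, ← coord m y]
  exact h0 (key m)

end TwoSidedSystem

/-! ### Indicator functions of clopen sets -/

/-- The indicator function of a clopen set, as a continuous complex-valued function. -/
def clopenIndicator {Y : Type*} [TopologicalSpace Y] (P : Set Y) (hP : IsClopen P) : C(Y, ℂ) :=
  ⟨P.indicator 1, (continuous_const (y := (1 : ℂ))).indicator fun x hx => by
    rw [hP.frontier_eq] at hx
    exact hx.elim⟩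

section clopenIndicator

variable {Y : Type*} [TopologicalSpace Y] {P Q : Set Y} (hP : IsClopen P) (hQ : IsClopen Q)

lemma clopenIndicator_of_mem {x : Y} (hx : x ∈ P) : clopenIndicator P hP x = 1 :=
  Set.indicator_of_mem hx 1

lemma clopenIndicator_of_notMem {x : Y} (hx : x ∉ P) : clopenIndicator P hP x = 0 :=
  Set.indicator_of_notMem hx 1

lemma isStarProjection_clopenIndicator : IsStarProjection (clopenIndicator P hP) := by
  constructor <;> ext x <;> by_cases hx : x ∈ P <;>
    simp [clopenIndicator_of_mem, clopenIndicator_of_notMem, hx]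

lemma clopenIndicator_inter :
    clopenIndicator (P ∩ Q) (hP.inter hQ) = clopenIndicator P hP * clopenIndicator Q hQ := by
  ext x
  by_cases hx : x ∈ P <;> by_cases hx' : x ∈ Q <;>
    simp [clopenIndicator_of_mem, clopenIndicator_of_notMem, hx, hx']

lemma clopenIndicator_union :
    clopenIndicator (P ∪ Q) (hP.union hQ) = clopenIndicator P hP + clopenIndicator Q hQ -
      clopenIndicator P hP * clopenIndicator Q hQ := by
  ext x
  by_cases hx : x ∈ P <;> by_cases hx' : x ∈ Q <;>
    simp [clopenIndicator_of_mem, clopenIndicator_of_notMem, hx, hx']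

lemma clopenIndicator_compl : clopenIndicator Pᶜ hP.compl = 1 - clopenIndicator P hP := by
  ext x
  by_cases hx : x ∈ P <;> simp [clopenIndicator_of_mem, clopenIndicator_of_notMem, hx]

end clopenIndicator

/-- A ⋆-homomorphism between C⋆-algebras is continuous. -/
lemma StarAlgHom.continuous_of_cstar {A : Type v} {B : Type w} [CStarAlgebra A] [CStarAlgebra B]
    (φ : A →⋆ₐ[ℂ] B) : Continuous φ :=
  AddMonoidHomClass.continuous_of_bound φ 1 fun x => by
    simpa using NonUnitalStarAlgHom.norm_apply_le φ x

namespace ShiftSpace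

variable {𝔞 : Type u} [TopologicalSpace 𝔞] (X : ShiftSpace 𝔞)

lemma continuous_power_symm (g : FreeGroup 𝔞) : Continuous (X.power g).symm := by
  induction g using FreeGroup.induction_on with
  | C1 => exact continuous_id
  | of a => rw [TwoSidedSystem.power_of]; exact X.tauHomeo.continuous
  | inv_of a _ =>
    rw [map_inv, TwoSidedSystem.power_of]
    exact X.tauHomeo.symm.continuous
  | mul g h hg hh =>
    rw [map_mul]
    exact hh.comp hg

variable [DiscreteTopology 𝔞]

lemma isClopen_dom (g : FreeGroup 𝔞) : IsClopen (X.dom g) := by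
  classical
  have h (w : List (𝔞 × Bool)) : IsClopen (X.wordMap w).target := by
    induction w with
    | nil => exact isClopen_univ
    | cons b w ih =>
      have : (X.wordMap (b :: w)).target = (X.symbolMap b).target ∩
          (X.power (FreeGroup.mk [b])).symm ⁻¹' (X.wordMap w).target :=
        Set.ext fun x => X.mem_target_cons b w x
      rw [this, TwoSidedSystem.symbolMap_target]
      refine IsClopen.inter ?_ (ih.preimage (X.continuous_power_symm _))
      exact (isClopen_discrete {b.1}).preimage
        ((continuous_apply _).comp continuous_subtype_val)
  exact h _

lemma isClopen_of_mem_boolAlg {P : Set X.Pt} (hP : P ∈ X.partialAction.boolAlg) : IsClopen P := by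
  induction hP using BooleanSubalgebra.closure_bot_sup_induction with
  | mem _ h =>
    obtain ⟨g, rfl⟩ := h
    exact X.isClopen_dom g
  | bot => exact isClopen_empty
  | sup P _ Q _ hP hQ => exact hP.union hQ
  | compl P _ hP => exact hP.compl

/-- The indicator function `1_{D_g}` as a continuous function on `X`. -/
def domIndicator (g : FreeGroup 𝔞) : C(X.Pt, ℂ) := clopenIndicator (X.dom g) (X.isClopen_dom g)

variable {X} in
lemma domIndicator_of_mem {g : FreeGroup 𝔞} {x : X.Pt} (hx : x ∈ X.dom g) :
    X.domIndicator g x = 1 := clopenIndicator_of_mem _ hx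

variable {X} in
lemma domIndicator_of_notMem {g : FreeGroup 𝔞} {x : X.Pt} (hx : x ∉ X.dom g) :
    X.domIndicator g x = 0 := clopenIndicator_of_notMem _ hx

lemma domIndicator_one : X.domIndicator 1 = 1 := by
  ext x
  exact domIndicator_of_mem (by rw [TwoSidedSystem.dom_one]; trivial)

lemma isStarProjection_domIndicator (g : FreeGroup 𝔞) : IsStarProjection (X.domIndicator g) :=
  isStarProjection_clopenIndicator _

lemma domIndicator_eq_iff {g : FreeGroup 𝔞} {x y : X.Pt} :
    X.domIndicator g x = X.domIndicator g y ↔ (x ∈ X.dom g ↔ y ∈ X.dom g) := by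
  by_cases hx : x ∈ X.dom g <;> by_cases hy : y ∈ X.dom g <;>
    simp [domIndicator_of_mem, domIndicator_of_notMem, hx, hy]

lemma eq_of_domIndicator_eq {x y : X.Pt} (h : ∀ g, X.domIndicator g x = X.domIndicator g y) :
    x = y :=
  X.eq_of_mem_dom_iff fun g => X.domIndicator_eq_iff.1 (h g)

variable [Finite 𝔞]

/-- By the Stone–Weierstrass theorem, as the domains separate points. -/
theorem adjoin_domIndicator :
    (StarAlgebra.adjoin ℂ (Set.range X.domIndicator)).topologicalClosure = ⊤ := by
  apply ContinuousMap.starSubalgebra_topologicalClosure_eq_top_of_separatesPoints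
  intro x y hxy
  by_contra! hne
  refine hxy (X.eq_of_domIndicator_eq fun g => hne _ ⟨_, ?_, rfl⟩)
  exact StarAlgebra.subset_adjoin ℂ _ ⟨g, rfl⟩

lemma domIndicator_induction {S : StarSubalgebra ℂ C(X.Pt, ℂ)} (hS : IsClosed (S : Set C(X.Pt, ℂ)))
    (h : ∀ g, X.domIndicator g ∈ S) (f : C(X.Pt, ℂ)) : f ∈ S := by
  have h1 : (⊤ : StarSubalgebra ℂ C(X.Pt, ℂ)) ≤ S := by
    rw [← X.adjoin_domIndicator]
    refine StarSubalgebra.topologicalClosure_minimal (StarAlgebra.adjoin_le ?_) hS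
    rintro _ ⟨g, rfl⟩
    exact h g
  exact h1 trivial

lemma starAlgHom_ext {A : Type v} [CStarAlgebra A] {φ ψ : C(X.Pt, ℂ) →⋆ₐ[ℂ] A}
    (h : ∀ g, φ (X.domIndicator g) = ψ (X.domIndicator g)) : φ = ψ :=
  StarAlgHom.ext fun f => X.domIndicator_induction (S := StarAlgHom.equalizer φ ψ)
    (isClosed_eq φ.continuous_of_cstar ψ.continuous_of_cstar) h f

end ShiftSpace

/-! ### The representation of `C(X)` induced by a representation of the partial action -/

/-- A `ℂ`-valued Boolean homomorphism on a Boolean algebra of clopen subsets of a compact space is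
the evaluation at a point: the sets of value `1` are closed and directed, hence have a common
point. -/
lemma exists_point_of_boolean {Y : Type v} [TopologicalSpace Y] [CompactSpace Y]
    (L : BooleanSubalgebra (Set Y)) (hL : ∀ P ∈ L, IsClopen P) (v : L → ℂ)
    (hinf : ∀ P Q, v (P ⊓ Q) = v P * v Q) (hcompl : ∀ P, v Pᶜ = 1 - v P) :
    ∃ x : Y, ∀ P : L, v P = clopenIndicator P.1 (hL P.1 P.2) x := by
  have h01 (P : L) : v P = 0 ∨ v P = 1 := by
    have h := hinf P P
    rw [inf_idem] at h
    rcases eq_or_ne (v P) 0 with h0 | h0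
    · exact .inl h0
    · exact .inr (mul_left_cancel₀ h0 (by rw [mul_one]; exact h.symm))
  have hbot : v ⊥ = 0 := by
    rw [← inf_compl_eq_bot (a := (⊥ : L)), hinf, hcompl]
    rcases h01 ⊥ with h | h <;> simp [h]
  have htop : v ⊤ = 1 := by rw [← compl_bot, hcompl, hbot, sub_zero]
  have : Nonempty {P : L // v P = 1} := ⟨⟨⊤, htop⟩⟩
  obtain ⟨x, hx⟩ := IsCompact.nonempty_iInter_of_directed_nonempty_isCompact_isClosed
    (fun P : {P : L // v P = 1} => (P.1.1 : Set Y))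
    (fun P Q => ⟨⟨P.1 ⊓ Q.1, by rw [hinf, P.2, Q.2, one_mul]⟩, Set.inter_subset_left,
      Set.inter_subset_right⟩)
    (fun P => by
      rw [Set.nonempty_iff_ne_empty]
      intro h
      have h1 : P.1 = ⊥ := Subtype.ext h
      have h2 := P.2
      rw [h1, hbot] at h2
      exact zero_ne_one h2)
    (fun P => (hL _ P.1.2).1.isCompact) (fun P => (hL _ P.1.2).1)
  rw [Set.mem_iInter] at hx
  refine ⟨x, fun P => ?_⟩
  rcases h01 P with h | h
  · have : x ∈ (P.1 : Set Y)ᶜ := hx ⟨Pᶜ, by rw [hcompl, h, sub_zero]⟩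
    rw [h, clopenIndicator_of_notMem _ this]
  · rw [h, clopenIndicator_of_mem _ (hx ⟨P, h⟩)]

namespace PartialAction

instance isClosed_rangeAlg {G : Type u} {A : Type w} [CStarAlgebra A] (s : G → A) :
    IsClosed (rangeAlg s : Set A) :=
  StarSubalgebra.isClosed_topologicalClosure _

/-- The commutative C⋆-algebra generated by the range projections of a representation. -/
abbrev IsRepresentation.commCStarAlgebra {G : Type u} [Group G] {X : Type v}
    {θ : PartialAction G X} {A : Type w} [CStarAlgebra A] {s : G → A}
    (hs : θ.IsRepresentation s) : CommCStarAlgebra (rangeAlg s) where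
  __ := (inferInstance : CStarAlgebra (rangeAlg s))
  mul_comm := by
    have hc : ∀ a ∈ Set.range fun g => s g * star (s g), ∀ b ∈ Set.range fun g => s g * star (s g),
        a * b = b * a := by
      rintro _ ⟨g, rfl⟩ _ ⟨h, rfl⟩
      exact (hs.commute g h).eq
    have := StarAlgebra.isMulCommutative_adjoin ℂ hc (by
      rintro a ha _ ⟨h, rfl⟩
      simpa using hc a ha _ ⟨h, rfl⟩)
    exact (StarSubalgebra.commRingTopologicalClosure _ this.is_comm.comm).mul_comm

end PartialAction

namespace ShiftSpace

variable {𝔞 : Type u} [TopologicalSpace 𝔞] [DiscreteTopology 𝔞] [Finite 𝔞] (X : ShiftSpace 𝔞)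

/-- The domains `D_g` embed `X` into a product of copies of `ℂ`. -/
lemma isInducing_domIndicator :
    Topology.IsInducing fun (x : X.Pt) (g : FreeGroup 𝔞) => X.domIndicator g x :=
  (Continuous.isClosedEmbedding (by fun_prop) fun _ _ h =>
    X.eq_of_domIndicator_eq fun g => congrFun h g).isInducing

variable {X}

/-- A representation of `θ_X` induces a representation of `C(X)`. Each character of the commutative
C⋆-algebra of range projections is, on the projections `β(P)`, the evaluation at a point of `X`;
this gives a continuous map from the spectrum to `X`, and composition with it followed by the
inverse Gelfand transform is the required ⋆-homomorphism. -/
theorem exists_starAlgHom {A : Type w} [CStarAlgebra A] {s : FreeGroup 𝔞 → A}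
    (hs : X.partialAction.IsRepresentation s) :
    ∃ π : C(X.Pt, ℂ) →⋆ₐ[ℂ] A, ∀ g, π (X.domIndicator g) = s g * star (s g) := by
  let _ : CommCStarAlgebra (PartialAction.rangeAlg s) := hs.commCStarAlgebra
  obtain ⟨β, hβ, hinf, -, hcompl, hdom⟩ := hs.boolean
  let b (P : X.partialAction.boolAlg) : PartialAction.rangeAlg s := ⟨β P, (hβ P).2⟩
  have binf (P Q) : b (P ⊓ Q) = b P * b Q := Subtype.ext (hinf P Q)
  have bcompl (P) : b Pᶜ = 1 - b P := Subtype.ext (hcompl P)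
  have hpt (φ : WeakDual.characterSpace ℂ (PartialAction.rangeAlg s)) :=
    exists_point_of_boolean X.partialAction.boolAlg (fun _ => X.isClopen_of_mem_boolAlg)
      (fun P => φ (b P)) (fun P Q => by rw [binf, map_mul])
      (fun P => by rw [bcompl, map_sub, map_one])
  choose F hF using hpt
  have hFg (φ) (g : FreeGroup 𝔞) : X.domIndicator g (F φ) =
      φ (b ⟨X.partialAction.dom g, X.partialAction.dom_mem g⟩) :=
    (hF φ ⟨X.partialAction.dom g, X.partialAction.dom_mem g⟩).symm
  have hcont : Continuous F := by
    rw [X.isInducing_domIndicator.continuous_iff]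
    refine continuous_pi fun g => ?_
    change Continuous fun φ => X.domIndicator g (F φ)
    simp only [hFg]
    exact (gelfandStarTransform (PartialAction.rangeAlg s) _).continuous
  let e := (gelfandStarTransform (PartialAction.rangeAlg s)).symm
  refine ⟨((PartialAction.rangeAlg s).subtype.comp
    (e : C(WeakDual.characterSpace ℂ (PartialAction.rangeAlg s), ℂ) →⋆ₐ[ℂ] _)).comp
      (ContinuousMap.compStarAlgHom' ℂ ℂ ⟨F, hcont⟩), fun g => ?_⟩
  rw [← hdom g]
  change (e _).1 = (b ⟨X.partialAction.dom g, X.partialAction.dom_mem g⟩).1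
  congr 1
  rw [StarAlgEquiv.symm_apply_eq]
  ext φ
  exact hFg φ g

end ShiftSpace

/-! ### The unitary `∑ a, s_a` -/

namespace PartialAction.IsRepresentation

variable {G : Type u} [Group G] {X : Type v} {θ : PartialAction G X} {A : Type w} [CStarAlgebra A]
  {s : G → A}

lemma isStarProjection (hs : θ.IsRepresentation s) (g : G) :
    IsStarProjection (s g * star (s g)) :=
  ⟨by rw [IsIdempotentElem, ← mul_assoc, hs.partial_isometry], by simp [IsSelfAdjoint]⟩

/-- Range projections of disjoint domains are orthogonal. -/
lemma range_mul_range_eq_zero (hs : θ.IsRepresentation s) {g h : G}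
    (hgh : Disjoint (θ.dom g) (θ.dom h)) :
    s g * star (s g) * (s h * star (s h)) = 0 := by
  obtain ⟨β, hβ, hinf, -, hcompl, hdom⟩ := hs.boolean
  have hbot : β ⊥ = 0 := by
    have h1 := hinf ⊥ ⊥ᶜ
    rwa [hcompl ⊥, mul_sub, mul_one, (hβ ⊥).1.isIdempotentElem.eq, sub_self,
      inf_compl_eq_bot] at h1
  rw [← hdom, ← hdom, ← hinf, ← hbot]
  congr 1
  exact Subtype.ext hgh.inter_eq

/-- If `D_g ⊆ D_h`, then the range projection of `s_g` is below that of `s_h`. -/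
lemma range_mul_range_of_subset (hs : θ.IsRepresentation s) {g h : G}
    (hgh : θ.dom g ⊆ θ.dom h) :
    s g * star (s g) * (s h * star (s h)) = s g * star (s g) := by
  obtain ⟨β, -, hinf, -, -, hdom⟩ := hs.boolean
  rw [← hdom, ← hdom, ← hinf]
  congr 1
  exact Subtype.ext (Set.inter_eq_left.2 hgh)

lemma source (hs : θ.IsRepresentation s) (g : G) :
    star (s g) * s g = s g⁻¹ * star (s g⁻¹) := by
  rw [hs.inv, star_star]

/-- Conjugation of a range projection: `s_h s_g s_g^* s_h^*` is the projection of
`D_h ∩ D_{h g}`. -/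
lemma conj_range (hs : θ.IsRepresentation s) (h g : G) :
    s h * (s g * star (s g)) * star (s h) =
      s h * star (s h) * (s (h * g) * star (s (h * g))) := by
  have h1 : s h * (s g * star (s g)) * star (s h) = s h * s g * star (s h * s g) := by
    rw [star_mul]
    simp only [mul_assoc]
  have h2 := (hs.commute (h * g) h).eq
  rw [h1, hs.mul, star_mul, star_mul, star_star]
  calc s h * star (s h) * s (h * g) * (star (s (h * g)) * (s h * star (s h)))
      = s h * star (s h) * ((s (h * g) * star (s (h * g))) * (s h * star (s h))) := by
        simp only [mul_assoc]
    _ = s h * star (s h) * s h * star (s h) * (s (h * g) * star (s (h * g))) := by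
        rw [h2]
        simp only [mul_assoc]
    _ = _ := by rw [hs.partial_isometry]

lemma mul_range (hs : θ.IsRepresentation s) (h g : G) :
    s h * (s g * star (s g)) = s h * star (s h) * (s (h * g) * star (s (h * g))) * s h := by
  calc s h * (s g * star (s g)) = s h * (star (s h) * s h * (s g * star (s g))) := by
        rw [← mul_assoc (s h) (star (s h) * s h), ← mul_assoc (s h) (star (s h)),
          hs.partial_isometry]
    _ = s h * (s g * star (s g)) * star (s h) * s h := by
        rw [hs.source, (hs.commute h⁻¹ g).eq, ← hs.source]
        simp only [mul_assoc]
    _ = _ := by rw [hs.conj_range]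

lemma star_mul_eq_zero (hs : θ.IsRepresentation s) {g h : G}
    (hgh : Disjoint (θ.dom g) (θ.dom h)) : star (s g) * s h = 0 := by
  calc star (s g) * s h = star (s g * star (s g) * s g) * (s h * star (s h) * s h) := by
        rw [hs.partial_isometry, hs.partial_isometry]
    _ = star (s g) * (s g * star (s g) * (s h * star (s h))) * s h := by
        simp only [star_mul, star_star, mul_assoc]
    _ = 0 := by rw [hs.range_mul_range_eq_zero hgh, mul_zero, zero_mul]

end PartialAction.IsRepresentation

namespace ShiftSpace

variable {𝔞 : Type u} [TopologicalSpace 𝔞] {X : ShiftSpace 𝔞} {A : Type w} [CStarAlgebra A]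
  {s : FreeGroup 𝔞 → A}

lemma disjoint_dom_of (X : ShiftSpace 𝔞) {a b : 𝔞} (hab : a ≠ b) :
    Disjoint (X.partialAction.dom (FreeGroup.of a)) (X.partialAction.dom (FreeGroup.of b)) :=
  Set.disjoint_left.2 fun _ ha hb => hab ((X.mem_dom_of.1 ha).symm.trans (X.mem_dom_of.1 hb))

lemma disjoint_dom_of_inv (X : ShiftSpace 𝔞) {a b : 𝔞} (hab : a ≠ b) :
    Disjoint (X.partialAction.dom (FreeGroup.of a)⁻¹)
      (X.partialAction.dom (FreeGroup.of b)⁻¹) :=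
  Set.disjoint_left.2 fun _ ha hb =>
    hab ((X.mem_dom_of_inv.1 ha).symm.trans (X.mem_dom_of_inv.1 hb))

variable [Fintype 𝔞]

/-- Conjugation by `∑ a, s_a`: the terms `s_a p_g s_b^*` with `a ≠ b` vanish since the source
projections of `s_a` and `s_b` are orthogonal. -/
lemma sum_conj_range (hs : X.partialAction.IsRepresentation s) (g : FreeGroup 𝔞) :
    (∑ a, s (FreeGroup.of a)) * (s g * star (s g)) * star (∑ a, s (FreeGroup.of a)) =
      ∑ a, s (FreeGroup.of a) * star (s (FreeGroup.of a)) *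
        (s (FreeGroup.of a * g) * star (s (FreeGroup.of a * g))) := by
  rw [star_sum, Finset.sum_mul, Finset.sum_mul]
  refine Finset.sum_congr rfl fun a _ => ?_
  rw [Finset.mul_sum, Finset.sum_eq_single a, hs.conj_range]
  · intro b _ hba
    have h1 := hs.star_mul_eq_zero (X.disjoint_dom_of_inv hba.symm)
    rw [hs.inv, hs.inv, star_star] at h1
    rw [hs.mul_range, mul_assoc, h1, mul_zero]
  · simp

lemma range_mul_sum (hs : X.partialAction.IsRepresentation s) (a : 𝔞) :
    s (FreeGroup.of a) * star (s (FreeGroup.of a)) * ∑ b, s (FreeGroup.of b) =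
      s (FreeGroup.of a) := by
  rw [Finset.mul_sum, Finset.sum_eq_single a, hs.partial_isometry]
  · intro b _ hba
    rw [mul_assoc, hs.star_mul_eq_zero (X.disjoint_dom_of hba.symm), mul_zero]
  · simp

lemma range_inv_mul_star_sum (hs : X.partialAction.IsRepresentation s) (a : 𝔞) :
    s (FreeGroup.of a)⁻¹ * star (s (FreeGroup.of a)⁻¹) * star (∑ b, s (FreeGroup.of b)) =
      s (FreeGroup.of a)⁻¹ := by
  rw [star_sum, Finset.mul_sum, Finset.sum_eq_single a, ← hs.inv (FreeGroup.of a),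
    hs.partial_isometry]
  · intro b _ hba
    rw [← hs.inv (FreeGroup.of b), mul_assoc,
      hs.star_mul_eq_zero (X.disjoint_dom_of_inv hba.symm), mul_zero]
  · simp

/-- A representation `s` of `θ_X` is determined by its range projections and the unitary
`u = ∑ a, s_a`: `s_g = s_g s_g^* u^{|g|}`, where `|g|` is the exponent sum of `g`. The proof is
by induction on the reduced word of `g`, and reducedness enters through `D_{b w} ⊆ D_b`. -/
lemma range_mul_unitary (hs : X.partialAction.IsRepresentation s) (V : FreeGroup 𝔞 →* unitary A)
    (hV : ∀ a, (V (FreeGroup.of a) : A) = ∑ b, s (FreeGroup.of b)) (g : FreeGroup 𝔞) :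
    s g * star (s g) * V g = s g := by
  classical
  have hsymb (b : 𝔞 × Bool) :
      s (FreeGroup.mk [b]) * star (s (FreeGroup.mk [b])) * V (FreeGroup.mk [b]) =
        s (FreeGroup.mk [b]) := by
    obtain ⟨a, b⟩ := b
    cases b
    · change s (FreeGroup.of a)⁻¹ * star (s (FreeGroup.of a)⁻¹) * V (FreeGroup.of a)⁻¹ = _
      rw [map_inv, ← Unitary.star_eq_inv, Unitary.coe_star, hV, range_inv_mul_star_sum hs]
      rfl
    · change s (FreeGroup.of a) * star (s (FreeGroup.of a)) * V (FreeGroup.of a) = _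
      rw [hV, range_mul_sum hs]
      rfl
  have hw (w : List (𝔞 × Bool)) (h : FreeGroup.IsReduced w) :
      s (FreeGroup.mk w) * star (s (FreeGroup.mk w)) * V (FreeGroup.mk w) = s (FreeGroup.mk w) := by
    induction w with
    | nil =>
      rw [← FreeGroup.one_eq_mk, hs.one, map_one]
      simp
    | cons b w ih =>
      have ih := ih (h.infix (List.suffix_cons b w).isInfix)
      have hsub := hs.range_mul_range_of_subset (g := FreeGroup.mk (b :: w))
        (h := FreeGroup.mk [b]) (X.dom_cons_subset h)
      have hm := hs.mul (FreeGroup.mk [b]) (FreeGroup.mk w)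
      have hr := hs.mul_range (FreeGroup.mk [b]) (FreeGroup.mk w)
      rw [← TwoSidedSystem.mk_cons] at hm hr
      have hV' : (V (FreeGroup.mk (b :: w)) : A) = V (FreeGroup.mk [b]) * V (FreeGroup.mk w) := by
        rw [TwoSidedSystem.mk_cons, map_mul, Submonoid.coe_mul]
      have hp := (hs.isStarProjection (FreeGroup.mk (b :: w))).isIdempotentElem.eq
      have hbb := hsymb b
      have hi := hs.partial_isometry (FreeGroup.mk (b :: w))
      rw [hV']
      generalize s (FreeGroup.mk (b :: w)) * star (s (FreeGroup.mk (b :: w))) = p at *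
      generalize s (FreeGroup.mk [b]) * star (s (FreeGroup.mk [b])) = q at *
      calc p * (V (FreeGroup.mk [b]) * V (FreeGroup.mk w) : A)
          = p * q * V (FreeGroup.mk [b]) * V (FreeGroup.mk w) := by rw [hsub, mul_assoc]
        _ = p * s (FreeGroup.mk [b]) * V (FreeGroup.mk w) := by rw [mul_assoc p, hbb]
        _ = p * (q * p * s (FreeGroup.mk [b])) * V (FreeGroup.mk w) := by
            rw [← mul_assoc, ← mul_assoc, hsub, hp]
        _ = p * s (FreeGroup.mk [b]) * s (FreeGroup.mk w) := by
            rw [← hr, ← mul_assoc, mul_assoc (p * _), ih]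
        _ = p * q * s (FreeGroup.mk (b :: w)) := by rw [mul_assoc, hm, mul_assoc]
        _ = _ := by rw [hsub, hi]
  have := hw g.toWord FreeGroup.isReduced_toWord
  rwa [FreeGroup.mk_toWord] at this

variable [DiscreteTopology 𝔞]

/-- `τ^{-1}(D_g)` is the disjoint union of the sets `D_a ∩ D_{a g}`. -/
lemma tauStar_domIndicator (g : FreeGroup 𝔞) :
    X.tauStar (X.domIndicator g) =
      ∑ a, X.domIndicator (FreeGroup.of a) * X.domIndicator (FreeGroup.of a * g) := by
  ext x
  rw [tauStar_apply, ContinuousMap.sum_apply, Finset.sum_eq_single (x.1 0)]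
  · rw [ContinuousMap.mul_apply, domIndicator_of_mem (X.mem_dom_of.2 rfl), one_mul]
    have h := X.tau_mem_dom_iff (x := x) rfl g
    by_cases hx : X.tau x ∈ X.dom g
    · rw [domIndicator_of_mem hx, domIndicator_of_mem (h.1 hx)]
    · rw [domIndicator_of_notMem hx, domIndicator_of_notMem (mt h.2 hx)]
  · intro a _ ha
    rw [ContinuousMap.mul_apply, domIndicator_of_notMem (mt X.mem_dom_of.1 ha.symm), zero_mul]
  · simp

lemma sum_mem_unitary (hs : X.partialAction.IsRepresentation s) :
    ∑ a, s (FreeGroup.of a) ∈ unitary A := by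
  obtain ⟨π, hπ⟩ := exists_starAlgHom hs
  have h2 : ∑ a, X.domIndicator (FreeGroup.of a) = 1 := by
    have h := X.tauStar_domIndicator 1
    rw [domIndicator_one, map_one] at h
    rw [h]
    refine Finset.sum_congr rfl fun a _ => ?_
    rw [mul_one, (X.isStarProjection_domIndicator _).isIdempotentElem.eq]
  have h3 : ∑ a, X.domIndicator (FreeGroup.of a)⁻¹ = 1 := by
    ext x
    rw [ContinuousMap.sum_apply, Finset.sum_eq_single (x.1 (-1))]
    · exact domIndicator_of_mem (X.mem_dom_of_inv.2 rfl)
    · exact fun a _ ha => domIndicator_of_notMem (mt X.mem_dom_of_inv.1 ha.symm)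
    · simp
  rw [Unitary.mem_iff]
  constructor
  · rw [Finset.mul_sum, ← map_one π, ← h3, map_sum]
    refine Finset.sum_congr rfl fun a _ => ?_
    rw [hπ, star_sum, Finset.sum_mul, Finset.sum_eq_single a, hs.source]
    · exact fun b _ hba => hs.star_mul_eq_zero (X.disjoint_dom_of hba)
    · simp
  · have h := sum_conj_range hs 1
    rw [hs.one, star_one, mul_one, mul_one] at h
    rw [h, ← map_one π, ← h2, map_sum]
    refine Finset.sum_congr rfl fun a _ => ?_
    rw [mul_one, (hs.isStarProjection _).isIdempotentElem.eq, hπ]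

/-- The unitary `∑ a, s_a` implements the shift on `C(X)`. -/
lemma sum_covariant (hs : X.partialAction.IsRepresentation s) {π : C(X.Pt, ℂ) →⋆ₐ[ℂ] A}
    (hπ : ∀ g, π (X.domIndicator g) = s g * star (s g)) (f : C(X.Pt, ℂ)) :
    (∑ a, s (FreeGroup.of a)) * π f * star (∑ a, s (FreeGroup.of a)) = π (X.tauStar f) := by
  let u : unitary A := ⟨_, sum_mem_unitary hs⟩
  have h : ((Unitary.conjStarAlgAut ℂ A u : A ≃⋆ₐ[ℂ] A) : A →⋆ₐ[ℂ] A).comp π =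
      π.comp (X.tauStar : C(X.Pt, ℂ) →⋆ₐ[ℂ] C(X.Pt, ℂ)) := by
    refine X.starAlgHom_ext fun g => ?_
    change (∑ a, s (FreeGroup.of a)) * π (X.domIndicator g) * star (∑ a, s (FreeGroup.of a)) =
      π (X.tauStar (X.domIndicator g))
    rw [hπ, sum_conj_range hs, tauStar_domIndicator, map_sum]
    simp only [map_mul, hπ]
  exact DFunLike.congr_fun h f

end ShiftSpace

/-! ### The representation of the partial action in the crossed product -/

namespace ShiftSpace

section Translate

variable {𝔞 : Type u} [TopologicalSpace 𝔞] (X : ShiftSpace 𝔞)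

/-- The function `f ∘ θ_g⁻¹`, where the partial map `θ_g` is extended to all of `X` as a power of
the shift. -/
def translate (g : FreeGroup 𝔞) (f : C(X.Pt, ℂ)) : C(X.Pt, ℂ) :=
  f.comp ⟨(X.power g).symm, X.continuous_power_symm g⟩

lemma translate_apply (g : FreeGroup 𝔞) (f : C(X.Pt, ℂ)) (x : X.Pt) :
    X.translate g f x = f ((X.power g).symm x) := rfl

lemma translate_one (f : C(X.Pt, ℂ)) : X.translate 1 f = f := by
  ext x
  rw [translate_apply, map_one]
  rfl

lemma translate_mul (g h : FreeGroup 𝔞) (f : C(X.Pt, ℂ)) :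
    X.translate (g * h) f = X.translate g (X.translate h f) := by
  ext x
  rw [translate_apply, map_mul]
  rfl

lemma translate_of (a : 𝔞) (f : C(X.Pt, ℂ)) : X.translate (FreeGroup.of a) f = X.tauStar f := by
  ext x
  rw [translate_apply, TwoSidedSystem.power_of]
  rfl

variable [Finite 𝔞]

/-- The unitary of the crossed product that implements `θ_g`. -/
def crossedUnitary : FreeGroup 𝔞 →* unitary (CrossedProduct X.tauStar) :=
  FreeGroup.lift fun _ => ⟨CrossedProduct.U X.tauStar, CrossedProduct.U_mem X.tauStar⟩

lemma crossedUnitary_of (a : 𝔞) :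
    (X.crossedUnitary (FreeGroup.of a) : CrossedProduct X.tauStar) =
      CrossedProduct.U X.tauStar := by
  rw [crossedUnitary, FreeGroup.lift_apply_of]

lemma star_crossedUnitary (g : FreeGroup 𝔞) :
    star (X.crossedUnitary g : CrossedProduct X.tauStar) = X.crossedUnitary g⁻¹ := by
  rw [map_inv, ← Unitary.star_eq_inv, Unitary.coe_star]

lemma crossedUnitary_mul_star (g : FreeGroup 𝔞) :
    (X.crossedUnitary g : CrossedProduct X.tauStar) *
      star (X.crossedUnitary g : CrossedProduct X.tauStar) = 1 :=
  Unitary.mul_star_self_of_mem (X.crossedUnitary g).2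

lemma star_crossedUnitary_mul (g : FreeGroup 𝔞) :
    star (X.crossedUnitary g : CrossedProduct X.tauStar) * X.crossedUnitary g = 1 :=
  Unitary.star_mul_self_of_mem (X.crossedUnitary g).2

lemma crossedUnitary_mul_ι (g : FreeGroup 𝔞) : ∀ f : C(X.Pt, ℂ),
    (X.crossedUnitary g : CrossedProduct X.tauStar) * CrossedProduct.ι X.tauStar f =
      CrossedProduct.ι X.tauStar (X.translate g f) * X.crossedUnitary g := by
  induction g using FreeGroup.induction_on with
  | C1 =>
    intro f
    rw [map_one, translate_one]
    exact (Commute.one_left _).eq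
  | of a =>
    intro f
    rw [translate_of, ← CrossedProduct.covariance, ← crossedUnitary_of X a, mul_assoc,
      X.star_crossedUnitary_mul, mul_one]
  | inv_of a h =>
    intro f
    have h1 := h (X.translate (FreeGroup.of a)⁻¹ f)
    rw [← translate_mul, mul_inv_cancel, translate_one] at h1
    rw [← star_crossedUnitary]
    calc _ = star (X.crossedUnitary (FreeGroup.of a) : CrossedProduct X.tauStar) *
          (CrossedProduct.ι X.tauStar f * X.crossedUnitary (FreeGroup.of a)) *
          star (X.crossedUnitary (FreeGroup.of a) : CrossedProduct X.tauStar) := by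
          rw [mul_assoc, mul_assoc, crossedUnitary_mul_star, mul_one]
      _ = _ := by
          rw [← h1, ← mul_assoc, star_crossedUnitary_mul, one_mul]
  | mul g h hg hh =>
    intro f
    rw [map_mul, Submonoid.coe_mul, mul_assoc, hh, ← mul_assoc, hg, translate_mul, mul_assoc]

end Translate

section DiscreteTopology

variable {𝔞 : Type u} [TopologicalSpace 𝔞] [DiscreteTopology 𝔞] (X : ShiftSpace 𝔞)

lemma domIndicator_mul_translate (g h : FreeGroup 𝔞) :
    X.domIndicator g * X.translate g (X.domIndicator h) =
      X.domIndicator g * X.domIndicator (g * h) := by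
  ext x
  rw [ContinuousMap.mul_apply, ContinuousMap.mul_apply, translate_apply]
  by_cases hx : x ∈ X.dom g
  · have h1 := X.power_symm_mem_dom_iff h hx
    by_cases hy : x ∈ X.dom (g * h)
    · rw [domIndicator_of_mem hy, domIndicator_of_mem (h1.2 hy)]
    · rw [domIndicator_of_notMem hy, domIndicator_of_notMem (mt h1.1 hy)]
  · rw [domIndicator_of_notMem hx, zero_mul, zero_mul]

lemma translate_domIndicator_inv (g : FreeGroup 𝔞) :
    X.translate g (X.domIndicator g⁻¹) = X.domIndicator g := by
  ext x
  have h := X.power_mem_dom_iff g⁻¹ x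
  rw [map_inv, inv_inv] at h
  change (X.power g).symm x ∈ _ ↔ _ at h
  rw [translate_apply]
  by_cases hx : x ∈ X.dom g
  · rw [domIndicator_of_mem hx, domIndicator_of_mem (h.2 hx)]
  · rw [domIndicator_of_notMem hx, domIndicator_of_notMem (mt h.1 hx)]

variable [Finite 𝔞]

/-- The partial isometries `1_{D_g} U^{|g|}` in the crossed product, where `|g|` is the exponent sum
of `g`. -/
def crossedRep (g : FreeGroup 𝔞) : CrossedProduct X.tauStar :=
  CrossedProduct.ι X.tauStar (X.domIndicator g) * X.crossedUnitary g

lemma crossedRep_mul_star (g : FreeGroup 𝔞) :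
    X.crossedRep g * star (X.crossedRep g) = CrossedProduct.ι X.tauStar (X.domIndicator g) := by
  rw [crossedRep, star_mul, mul_assoc, ← mul_assoc _ (star _), crossedUnitary_mul_star, one_mul,
    ← map_star, ← map_mul, (X.isStarProjection_domIndicator g).isSelfAdjoint.star_eq,
    (X.isStarProjection_domIndicator g).isIdempotentElem.eq]

lemma crossedRep_mul (g h : FreeGroup 𝔞) :
    X.crossedRep g * X.crossedRep h =
      CrossedProduct.ι X.tauStar (X.domIndicator g) * X.crossedRep (g * h) := by
  simp only [crossedRep]
  rw [mul_assoc, ← mul_assoc _ (CrossedProduct.ι _ _), crossedUnitary_mul_ι, mul_assoc,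
    ← mul_assoc, ← map_mul, domIndicator_mul_translate, map_mul, map_mul, Submonoid.coe_mul,
    mul_assoc]

lemma crossedRep_inv (g : FreeGroup 𝔞) : X.crossedRep g⁻¹ = star (X.crossedRep g) := by
  rw [crossedRep, crossedRep, star_mul, star_crossedUnitary, ← map_star,
    (X.isStarProjection_domIndicator g).isSelfAdjoint.star_eq, crossedUnitary_mul_ι]
  congr 2
  rw [← X.translate_domIndicator_inv g⁻¹, inv_inv]

/-- The family `1_{D_g} U^{|g|}` satisfies the relations of `θ_X`; the Boolean homomorphism sends a
(clopen) set to its indicator function. -/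
theorem isRepresentation_crossedRep :
    X.partialAction.IsRepresentation X.crossedRep where
  partial_isometry g := by
    rw [crossedRep_mul_star, crossedRep, ← mul_assoc, ← map_mul,
      (X.isStarProjection_domIndicator g).isIdempotentElem.eq]
  commute g h := by
    rw [crossedRep_mul_star, crossedRep_mul_star]
    exact (Commute.all _ _).map _
  one := by
    rw [crossedRep, domIndicator_one, map_one, map_one]
    exact one_mul 1
  inv := X.crossedRep_inv
  mul g h := by rw [crossedRep_mul, crossedRep_mul_star]
  boolean := by
    let ι := CrossedProduct.ι X.tauStar
    have hmem (f : C(X.Pt, ℂ)) : ι f ∈ PartialAction.rangeAlg X.crossedRep := by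
      refine X.domIndicator_induction (S := (PartialAction.rangeAlg X.crossedRep).comap ι)
        ((StarSubalgebra.isClosed_topologicalClosure _).preimage ι.continuous_of_cstar)
        (fun g => ?_) f
      refine StarSubalgebra.le_topologicalClosure _ (StarAlgebra.subset_adjoin ℂ _ ⟨g, ?_⟩)
      exact X.crossedRep_mul_star g
    refine ⟨fun P => ι (clopenIndicator P.1 (X.isClopen_of_mem_boolAlg P.2)),
      fun P => ⟨(isStarProjection_clopenIndicator _).map ι, hmem _⟩, fun P Q => ?_, fun P Q => ?_,
      fun P => ?_, fun g => (X.crossedRep_mul_star g).symm⟩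
    · rw [← map_mul, ← clopenIndicator_inter]
      rfl
    · rw [← map_mul, ← map_add, ← map_sub, ← clopenIndicator_union]
      rfl
    · rw [← map_one ι, ← map_sub, ← clopenIndicator_compl]
      rfl

end DiscreteTopology

lemma sum_crossedRep {𝔞 : Type u} [TopologicalSpace 𝔞] [DiscreteTopology 𝔞] [Fintype 𝔞]
    (X : ShiftSpace 𝔞) :
    ∑ a, X.crossedRep (FreeGroup.of a) = CrossedProduct.U X.tauStar := by
  simp only [crossedRep, crossedUnitary_of]
  have h := X.tauStar_domIndicator 1
  simp only [domIndicator_one, mul_one, map_one,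
    (X.isStarProjection_domIndicator _).isIdempotentElem.eq] at h
  rw [← Finset.sum_mul, ← map_sum, ← h, map_one, one_mul]

end ShiftSpace

end

/-! ### The isomorphism -/

theorem theorem7 {𝔞 : Type u} [Fintype 𝔞] [TopologicalSpace 𝔞] [DiscreteTopology 𝔞]
    (X : ShiftSpace 𝔞) :
    ∃ χ : FreeGroup 𝔞 → C(X.Pt, ℂ),
      (∀ g x, χ g x = (X.partialAction.dom g).indicator 1 x) ∧
      (StarAlgebra.adjoin ℂ (Set.range χ)).topologicalClosure = ⊤ ∧
      ∃ Φ : CrossedProduct X.tauStar ≃⋆ₐ[ℂ] X.partialAction.CStar,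
        (∀ g, Φ (CrossedProduct.ι X.tauStar (χ g)) =
          X.partialAction.s g * star (X.partialAction.s g)) ∧
        Φ (CrossedProduct.U X.tauStar) = ∑ a : 𝔞, X.partialAction.s (FreeGroup.of a) := by
  refine ⟨X.domIndicator, fun _ _ => rfl, X.adjoin_domIndicator, ?_⟩
  have hs := X.partialAction.isRepresentation_s
  obtain ⟨π, hπ⟩ := ShiftSpace.exists_starAlgHom hs
  have hu := ShiftSpace.sum_mem_unitary hs
  obtain ⟨Φ, ⟨hΦ, hΦU⟩, -⟩ := CrossedProduct.existsUnique_lift X.tauStar π _ hu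
    (ShiftSpace.sum_covariant hs hπ)
  obtain ⟨Ψ, hΨ, -⟩ := X.partialAction.existsUnique_lift X.crossedRep X.isRepresentation_crossedRep
  have h1 : Ψ.comp Φ = StarAlgHom.id ℂ _ := by
    have hι : (Ψ.comp Φ).comp (CrossedProduct.ι X.tauStar) = CrossedProduct.ι X.tauStar := by
      refine X.starAlgHom_ext fun g => ?_
      rw [StarAlgHom.comp_apply, StarAlgHom.comp_apply, hΦ, hπ, map_mul, map_star, hΨ,
        ShiftSpace.crossedRep_mul_star]
    refine CStarPresentation.hom_ext _ ?_
    rintro (f | _)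
    · exact DFunLike.congr_fun hι f
    · change Ψ (Φ (CrossedProduct.U X.tauStar)) = CrossedProduct.U X.tauStar
      rw [hΦU, map_sum]
      simp only [hΨ]
      exact X.sum_crossedRep
  have h2 : Φ.comp Ψ = StarAlgHom.id ℂ _ := by
    refine CStarPresentation.hom_ext _ fun g => ?_
    change Φ (Ψ (X.partialAction.s g)) = X.partialAction.s g
    let V : FreeGroup 𝔞 →* unitary X.partialAction.CStar :=
      (Unitary.map ⟨Φ.toAlgHom.toMonoidHom, map_star Φ⟩).toMonoidHom.comp X.crossedUnitary
    have hV (a : 𝔞) : (V (FreeGroup.of a) : X.partialAction.CStar) =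
        ∑ b, X.partialAction.s (FreeGroup.of b) := by
      rw [← hΦU, ← X.crossedUnitary_of a]
      rfl
    rw [hΨ, ShiftSpace.crossedRep, map_mul, hΦ, hπ]
    exact ShiftSpace.range_mul_unitary hs V hV g
  let e : CrossedProduct X.tauStar ≃⋆ₐ[ℂ] X.partialAction.CStar :=
    StarAlgEquiv.ofBijective Φ ⟨Function.LeftInverse.injective (DFunLike.congr_fun h1),
      Function.RightInverse.surjective (DFunLike.congr_fun h2)⟩
  exact ⟨e, fun g => (hΦ _).trans (hπ g), hΦU⟩
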